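/- Let $M_1(v)=(2\pi)^{-1/2}e^{-v^2/2}$ be the one-dimensional Maxwellian with temperature one and velocity zero, and let $\|\cdot\|$ be the norm of $H=L^2(M_1\,dx\,dv)$, $(x,v)\in\mathbb R\times\mathbb R$. Let $\mathcal L_1 f=\Pi_1 f-f$ be the linearized BGK operator, where $\Pi_1$ is, for each $x$, the orthogonal projection of $f(x,\cdot)$ in $L^2(M_1dv)$ onto $\mathrm{Span}\{1,v,v^2\}$. Let $n\in\mathbb N_0$, let $Z\subseteq\mathbb R$ be open, and let $T_*:Z\to(0,\infty)$ be of class $C^n$. Let $p=p(z,t)\in H$ ($z\in Z$, $t\ge 0$) be of class $C^n$ in $z$ as an $H$-valued function, and for $k\le n$ let $q^{(k)}=\partial_z^k p$ be of class $C^{n+1-k}$ in $t\in[0,\infty)$ as an $H$-valued function. Suppose that for all $m\le n$, $z\in Z$, $t\ge0$, $$\partial_t q^{(m)}+\sum_{k=0}^{m}\binom mk\,\partial_z^{m-k}\big(\sqrt{T_*}\big)\,v\,\partial_x q^{(k)}=\mathcal L_1 q^{(m)},$$ where $v\,\partial_x q^{(k)}\in H$ is understood in the sense of distributions in $(x,v)$.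 Then for every $N\le n$ the norm $\|q^{(N)}\|$ grows at most like $t^N$ for large time, $\|q^{(N)}(z,t)\|\lesssim C_N\,t^N$, where $C_N$ depends on the solution only through the norms of $\mathcal L_1^k\partial_t^l q^{(0)}$, $k,l\le N$, at time $0$. Precisely: for every $N\in\mathbb N_0$ and $B\in\mathbb R$ there is a constant $K\ge 0$, depending only on $N$ and $B$, such that in the above situation with any $n\ge N$, if $z\in Z$ satisfies $|\partial_z^m\sqrt{T_*}(z)|\le B\sqrt{T_*(z)}$ for $1\le m\le N$, then for every $$C_N> K\sum_{k=0}^N\sum_{l=0}^N\big\|\mathcal L_1^k\,\partial_t^l q^{(0)}(z,0)\big\|$$ one has $\|q^{(N)}(z,t)\|\le C_N\,t^N$ for all sufficiently large $t$. -/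

import Mathlib

open MeasureTheory ProbabilityTheory Set Filter Topology
open scoped ContDiff

noncomputable section

namespace LinBGK

/-- The Maxwellian `M₁(v) dv = (2π)^{-1/2} exp (-v²/2) dv` with temperature one, velocity zero and
density one. -/
abbrev maxwell : Measure ℝ := gaussianReal 0 1

/-- The measure `M₁(v) dx dv` on the phase space of points `(x, v)`. -/
abbrev phase : Measure (ℝ × ℝ) := (volume : Measure ℝ).prod maxwell

/-- The real Hilbert space `L²(M₁ dx dv)`. -/
abbrev PhaseL2 : Type := Lp ℝ 2 phase

/-- The basis of `Span {1, v, v²}` that is orthonormal for `⟨f, g⟩₁ = ∫ f g M₁ dv`: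
the normalized Hermite polynomials `1`, `v`, `(v² - 1) / √2`. -/
def chi : Fin 3 → ℝ → ℝ :=
  ![fun _ => 1, fun v => v, fun v => (v ^ 2 - 1) / √2]

/-- `⟨χᵢ, f(x, ·)⟩₁`. -/
def chiMoment (i : Fin 3) (f : ℝ × ℝ → ℝ) (x : ℝ) : ℝ :=
  ∫ w, chi i w * f (x, w) ∂maxwell

/-- The linearized BGK operator `Π₁ f - f` on functions of `(x, v)`, where
`Π₁ f = ∑ᵢ ⟨χᵢ, f⟩₁ χᵢ` acts in the variable `v` only. -/
def collision (f : ℝ × ℝ → ℝ) (y : ℝ × ℝ) : ℝ :=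
  (∑ i, chiMoment i f y.1 * chi i y.2) - f y

lemma memLp_chi (i : Fin 3) : MemLp (chi i) 2 maxwell := by
  have h4 : MemLp (fun v : ℝ => v) 4 maxwell :=
    memLp_id_gaussianReal' 4 (by norm_num)
  have h2 : MemLp (fun v : ℝ => v) 2 maxwell :=
    memLp_id_gaussianReal' 2 (by norm_num)
  have hT : ENNReal.HolderTriple 4 4 2 := ⟨by
    rw [← two_mul, show (4 : ENNReal) = 2 * 2 by norm_num,
      ENNReal.mul_inv (by norm_num) (by norm_num), ← mul_assoc,
      ENNReal.mul_inv_cancel (by norm_num) (by norm_num), one_mul]⟩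
  have hsq : MemLp (fun v : ℝ => v ^ 2) 2 maxwell := by
    have := MemLp.mul' (r := 2) h4 h4
    simpa [pow_two] using this
  fin_cases i
  · exact memLp_const 1
  · exact h2
  · have := (hsq.sub (memLp_const (1 : ℝ))).const_mul (√2)⁻¹
    refine this.congr_norm ?_ ?_
    · simp only [chi]
      exact (by fun_prop : Measurable fun v : ℝ => (v ^ 2 - 1) / √2).aestronglyMeasurable
    · refine Eventually.of_forall fun v => ?_
      simp [chi, div_eq_inv_mul]

lemma sq_integral_mul_le {f g : ℝ → ℝ} (hf : MemLp f 2 maxwell) (hg : MemLp g 2 maxwell) :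
    (∫ w, f w * g w ∂maxwell) ^ 2 ≤ (∫ w, f w ^ 2 ∂maxwell) * ∫ w, g w ^ 2 ∂maxwell := by
  have h := integral_mul_norm_le_Lp_mul_Lq (μ := maxwell) (f := f) (g := g)
    Real.HolderConjugate.two_two (by simpa using hf) (by simpa using hg)
  have h1 : |∫ w, f w * g w ∂maxwell| ≤ ∫ a, ‖f a‖ * ‖g a‖ ∂maxwell := by
    have := norm_integral_le_integral_norm (μ := maxwell) (fun w => f w * g w)
    simpa [norm_mul] using this
  have e : ∀ u : ℝ → ℝ, (∫ a, ‖u a‖ ^ (2 : ℝ) ∂maxwell) = ∫ a, u a ^ 2 ∂maxwell := by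
    intro u; simp
  rw [e, e, ← Real.sqrt_eq_rpow, ← Real.sqrt_eq_rpow] at h
  have hA : 0 ≤ ∫ a, f a ^ 2 ∂maxwell := integral_nonneg fun _ => sq_nonneg _
  have hB : 0 ≤ ∫ a, g a ^ 2 ∂maxwell := integral_nonneg fun _ => sq_nonneg _
  calc (∫ w, f w * g w ∂maxwell) ^ 2 = |∫ w, f w * g w ∂maxwell| ^ 2 := (sq_abs _).symm
    _ ≤ (√(∫ a, f a ^ 2 ∂maxwell) * √(∫ a, g a ^ 2 ∂maxwell)) ^ 2 := by
        gcongr; exact h1.trans h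
    _ = _ := by rw [mul_pow, Real.sq_sqrt hA, Real.sq_sqrt hB]

lemma memLp_chiMoment_mul_chi (i : Fin 3) {f : ℝ × ℝ → ℝ} (hf : MemLp f 2 phase) :
    MemLp (fun y : ℝ × ℝ => chiMoment i f y.1 * chi i y.2) 2 phase := by
  have hchi := memLp_chi i
  have hfi : Integrable (fun y => f y ^ 2) phase := (memLp_two_iff_integrable_sq hf.1).1 hf
  have hm : AEStronglyMeasurable (chiMoment i f) volume := by
    have h : AEStronglyMeasurable (fun y : ℝ × ℝ => chi i y.2 * f y) phase :=
      hchi.1.comp_snd.mul hf.1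
    exact h.integral_prod_right'
  have hmi : Integrable (fun x => chiMoment i f x ^ 2) volume := by
    refine (hfi.integral_prod_left.const_mul (∫ w, chi i w ^ 2 ∂maxwell)).mono' (hm.pow 2) ?_
    filter_upwards [hfi.prod_right_ae, hf.1.prodMk_left] with x hx hx'
    have hfx : MemLp (fun w => f (x, w)) 2 maxwell := (memLp_two_iff_integrable_sq hx').2 hx
    have := sq_integral_mul_le hchi hfx
    simpa [chiMoment] using this
  refine (memLp_two_iff_integrable_sq (hm.comp_fst.mul hchi.1.comp_snd)).2 ?_
  have := hmi.mul_prod ((memLp_two_iff_integrable_sq hchi.1).1 hchi)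
  simpa [mul_pow] using this

lemma memLp_collision {f : ℝ × ℝ → ℝ} (hf : MemLp f 2 phase) : MemLp (collision f) 2 phase :=
  (memLp_finsetSum _ fun i _ => memLp_chiMoment_mul_chi i hf).sub hf

/-- The operator `𝓛₁` on `L²(M₁ dx dv)`. -/
def L1 (f : PhaseL2) : PhaseL2 := (memLp_collision (Lp.memLp f)).toLp (collision f)

/-- `v ∂ₓ f = g` in the sense of distributions on `ℝ × ℝ`. -/
def IsTransport (f g : PhaseL2) : Prop :=
  ∀ φ : ℝ × ℝ → ℝ, ContDiff ℝ ∞ φ → HasCompactSupport φ →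
    ∫ y : ℝ × ℝ, f y * (y.2 * fderiv ℝ φ y (1, 0)) = -∫ y : ℝ × ℝ, g y * φ y

/-- `q⁽ᵏ⁾(z, t) = ∂_z^k p (z, t)`, for `p` with values in `L²(M₁ dx dv)`. -/
def q (p : ℝ → ℝ → PhaseL2) (k : ℕ) (z t : ℝ) : PhaseL2 :=
  iteratedDeriv k (fun s => p s t) z

/-- `∂_z^k √T` at `z`. -/
def sqrtDeriv (T : ℝ → ℝ) (k : ℕ) (z : ℝ) : ℝ := iteratedDeriv k (fun s => √(T s)) z

/-- `p (z, t)`, for `z` in `Z` and `t` in `[0, ∞)`, is a strong solution in `L²(M₁ dx dv)`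
for which `q⁽ᵐ⁾ = ∂_z^m p` satisfies
`∂ₜ q⁽ᵐ⁾ + ∑_{k ≤ m} (m choose k) ∂_z^{m-k}(√T) v ∂ₓ q⁽ᵏ⁾ = 𝓛₁ q⁽ᵐ⁾` for all `m ≤ n`. -/
structure IsSolution (n : ℕ) (Z : Set ℝ) (T : ℝ → ℝ) (p : ℝ → ℝ → PhaseL2) : Prop where
  /-- `p` is `n` times continuously differentiable in `z`. -/
  contDiffOn_z : ∀ t, 0 ≤ t → ContDiffOn ℝ n (fun s => p s t) Z
  /-- `q⁽ᵏ⁾` is `n + 1 - k` times continuously differentiable in time, up to `t = 0`. -/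
  contDiffOn_t : ∀ z ∈ Z, ∀ k ≤ n,
    ContDiffOn ℝ ((n + 1 - k : ℕ) : WithTop ℕ∞) (fun t => q p k z t) (Ici 0)
  /-- The equations; `w k` is `v ∂ₓ q⁽ᵏ⁾`. -/
  eqn : ∀ z ∈ Z, ∀ t, 0 ≤ t → ∀ m ≤ n, ∃ w : ℕ → PhaseL2,
    (∀ k ≤ m, IsTransport (q p k z t) (w k)) ∧
    derivWithin (fun s => q p m z s) (Ici 0) t
      + ∑ k ∈ Finset.range (m + 1), ((m.choose k : ℝ) * sqrtDeriv T (m - k) z) • w k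
      = L1 (q p m z t)

/-- `∑_{k, l ≤ N} ‖𝓛₁^k ∂ₜ^l q⁽⁰⁾‖` at time zero. -/
def dataNorm (p : ℝ → ℝ → PhaseL2) (N : ℕ) (z : ℝ) : ℝ :=
  ∑ k ∈ Finset.range (N + 1), ∑ l ∈ Finset.range (N + 1),
    ‖L1^[k] (iteratedDerivWithin l (fun t => q p 0 z t) (Ici 0) 0)‖

end LinBGK

end

/-! The apparent loss of a derivative in the source terms `v ∂ₓ q⁽ʲ⁾`, `j < k`, is traded for a time
derivative. Write `Q k l = ∂ₜ^l q⁽ᵏ⁾` and `W k l = √T v ∂ₓ Q k l`. The coefficients do not depend on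
time, so every `Q k l` with `k + l ≤ N` obeys `Q k (l+1) + W k l + ∑_{j<k} β k j W j l = 𝓛₁ (Q k
l)`.

Since `𝓛₁` is dissipative and `W k l ⟂ Q k l`, the energy identity bounds the growth of `‖Q k l‖` by
`b ∑_{j<k} ‖W j l‖`. The equation itself, read as a formula for `W k l`, bounds `W k l` by `Q k l`,
`Q k (l+1)` and the lower `W j l`. So if the `W j l` with `j < k` grow at most like `t^j`, one
integration gives `t^k` for `Q k l`, hence for `W k l`. Initial values at levels `k ≥ 1` are
constants absorbed by `t^k`; only those of level `0` enter the final constant. This is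
`growsLike_of_hierarchy`.

The analytic point is `IsTransport.inner_eq_zero`: a distributional `v ∂ₓ` is skew on its maximal
domain, proved through the isometric free-streaming group. `isTransport_transportTerm` shows that
the `W k l` computed from the equations really are transport terms. -/

namespace LinBGK

/-! ### The collision operator: dissipativity, contraction, linearity -/

section Collision

/-- The moments are the derivatives at zero of the moment generating function `exp (t²/2)`. -/
lemma maxwell_moments :
    (∫ v, v ∂maxwell) = 0 ∧ (∫ v, v ^ 2 ∂maxwell) = 1 ∧ (∫ v, v ^ 3 ∂maxwell) = 0 ∧
      (∫ v, v ^ 4 ∂maxwell) = 3 := by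
  have hmgf : mgf id maxwell = fun t => Real.exp (t ^ 2 / 2) := by
    rw [mgf_id_gaussianReal]; simp
  have key : ∀ n, iteratedDeriv n (fun t : ℝ => Real.exp (t ^ 2 / 2)) 0 = ∫ v, v ^ n ∂maxwell := by
    intro n
    rw [← hmgf, iteratedDeriv_mgf_zero (by simp [integrableExpSet_id_gaussianReal])]
    simp
  have hexp : ∀ t : ℝ, HasDerivAt (fun t : ℝ => Real.exp (t ^ 2 / 2))
      (t * Real.exp (t ^ 2 / 2)) t := fun t => by
    have h := ((hasDerivAt_pow 2 t).div_const 2).exp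
    exact h.congr_deriv (by push_cast; ring)
  have d1 : deriv (fun t : ℝ => Real.exp (t ^ 2 / 2)) = fun t => t * Real.exp (t ^ 2 / 2) :=
    funext fun t => (hexp t).deriv
  have d2 : deriv (fun t : ℝ => t * Real.exp (t ^ 2 / 2)) =
      fun t => (1 + t ^ 2) * Real.exp (t ^ 2 / 2) := funext fun t =>
    (((hasDerivAt_id t).mul (hexp t)).congr_deriv (by simp; ring)).deriv
  have d3 : deriv (fun t : ℝ => (1 + t ^ 2) * Real.exp (t ^ 2 / 2)) =
      fun t => (3 * t + t ^ 3) * Real.exp (t ^ 2 / 2) := funext fun t =>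
    ((((hasDerivAt_pow 2 t).const_add 1).mul (hexp t)).congr_deriv (by push_cast; ring)).deriv
  have d4 : deriv (fun t : ℝ => (3 * t + t ^ 3) * Real.exp (t ^ 2 / 2)) =
      fun t => (3 + 6 * t ^ 2 + t ^ 4) * Real.exp (t ^ 2 / 2) := funext fun t =>
    (((((hasDerivAt_id t).const_mul 3).add (hasDerivAt_pow 3 t)).mul (hexp t)).congr_deriv
      (by simp; ring)).deriv
  refine ⟨?_, ?_, ?_, ?_⟩
  · exact integral_id_gaussianReal
  · simpa [iteratedDeriv_succ, d1, d2] using (key 2).symm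
  · simpa [iteratedDeriv_succ, d1, d2, d3] using (key 3).symm
  · simpa [iteratedDeriv_succ, d1, d2, d3, d4] using (key 4).symm

lemma integral_chi_mul_chi (i j : Fin 3) :
    ∫ v, chi i v * chi j v ∂maxwell = if i = j then 1 else 0 := by
  obtain ⟨h1, h2, h3, h4⟩ := maxwell_moments
  have hint : ∀ n : ℕ, Integrable (fun v : ℝ => v ^ n) maxwell := fun n => by
    have h := (memLp_id_gaussianReal (μ := 0) (v := 1) n).integrable_norm_pow'
    exact (integrable_norm_iff (by fun_prop)).1 (by simpa using h)
  have poly : ∀ a b c d e : ℝ,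
      ∫ v, (a + b * v + c * v ^ 2 + d * v ^ 3 + e * v ^ 4) ∂maxwell = a + c + 3 * e := by
    intro a b c d e
    have i1 : Integrable (fun v : ℝ => b * v) maxwell := by simpa using (hint 1).const_mul b
    have e1 : ∫ v, b * v ∂maxwell = 0 := by rw [integral_const_mul, h1, mul_zero]
    have i2 := (hint 2).const_mul c
    have i3 := (hint 3).const_mul d
    have i4 := (hint 4).const_mul e
    have i0 : Integrable (fun _ : ℝ => a) maxwell := integrable_const a
    have j1 : Integrable (fun v : ℝ => a + b * v) maxwell := i0.add i1
    have j2 : Integrable (fun v : ℝ => a + b * v + c * v ^ 2) maxwell := j1.add i2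
    have j3 : Integrable (fun v : ℝ => a + b * v + c * v ^ 2 + d * v ^ 3) maxwell := j2.add i3
    rw [integral_add j3 i4, integral_add j2 i3, integral_add j1 i2, integral_add i0 i1, e1]
    simp only [integral_const_mul, h2, h3, h4, integral_const]
    simp; ring
  have hs : √2 * √2 = (2 : ℝ) := Real.mul_self_sqrt (by norm_num)
  have hs0 : √2 ≠ (0 : ℝ) := by positivity
  have red : ∀ a b c d e : ℝ, (∀ v, chi i v * chi j v = a + b * v + c * v ^ 2 + d * v ^ 3 + e * v ^ 4)
      → ∫ v, chi i v * chi j v ∂maxwell = a + c + 3 * e := fun a b c d e h => by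
    rw [← poly a b c d e]; simp only [h]
  fin_cases i <;> fin_cases j
  · rw [red 1 0 0 0 0 (fun v => by simp [chi])]; simp
  · rw [red 0 1 0 0 0 (fun v => by simp [chi])]; simp
  · rw [red (-1 / √2) 0 (1 / √2) 0 0 (fun v => by simp [chi]; ring)]; simp; ring
  · rw [red 0 1 0 0 0 (fun v => by simp [chi])]; simp
  · rw [red 0 0 1 0 0 (fun v => by simp [chi]; ring)]; simp
  · rw [red 0 (-1 / √2) 0 (1 / √2) 0 (fun v => by simp [chi]; ring)]; simp
  · rw [red (-1 / √2) 0 (1 / √2) 0 0 (fun v => by simp [chi]; ring)]; simp; ring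
  · rw [red 0 (-1 / √2) 0 (1 / √2) 0 (fun v => by simp [chi]; ring)]; simp
  · rw [red (1 / 2) 0 (-1) 0 (1 / 2) (fun v => by
      simp only [chi]; simp; rw [div_mul_div_comm, hs]; ring)]
    simp; norm_num

lemma ae_memLp_fiber {f : ℝ × ℝ → ℝ} (hf : MemLp f 2 phase) :
    ∀ᵐ x, MemLp (fun w => f (x, w)) 2 maxwell := by
  have hfi : Integrable (fun y => f y ^ 2) phase := (memLp_two_iff_integrable_sq hf.1).1 hf
  filter_upwards [hfi.prod_right_ae, hf.1.prodMk_left] with x hx hx'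
  exact (memLp_two_iff_integrable_sq hx').2 hx

/-- On a fibre `collision f = Πf - f` is orthogonal to each `chi j`, hence to `Πf`; substituting `f
= Πf - collision f` in the second factor leaves minus the square. -/
lemma integral_collision_mul_fiber {f : ℝ × ℝ → ℝ} {x : ℝ}
    (hf : MemLp (fun w => f (x, w)) 2 maxwell) :
    ∫ w, collision f (x, w) * f (x, w) ∂maxwell =
      -∫ w, collision f (x, w) * collision f (x, w) ∂maxwell := by
  have hP : MemLp (fun w => ∑ i, chiMoment i f x * chi i w) 2 maxwell :=
    memLp_finsetSum _ fun i _ => (memLp_chi i).const_mul _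
  have hC : MemLp (fun w => collision f (x, w)) 2 maxwell := hP.sub hf
  have horth : ∀ j, ∫ w, collision f (x, w) * chi j w ∂maxwell = 0 := by
    intro j
    have e : ∀ w, collision f (x, w) * chi j w =
        (∑ i, chiMoment i f x * (chi i w * chi j w)) - chi j w * f (x, w) := fun w => by
      simp only [collision, sub_mul, Finset.sum_mul, mul_assoc]; ring
    have hi : ∀ i, Integrable (fun w => chiMoment i f x * (chi i w * chi j w)) maxwell :=
      fun i => ((memLp_chi i).integrable_mul (memLp_chi j)).const_mul _
    have hj : Integrable (fun w => chi j w * f (x, w)) maxwell := (memLp_chi j).integrable_mul hf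
    simp only [e]
    rw [integral_sub (integrable_finsetSum _ fun i _ => hi i) hj, integral_finsetSum _ fun i _ => hi i]
    simp only [integral_const_mul, integral_chi_mul_chi]
    simp [chiMoment]
  have e : ∀ w, collision f (x, w) * f (x, w) =
      (∑ i, chiMoment i f x * (collision f (x, w) * chi i w))
        - collision f (x, w) * collision f (x, w) := fun w => by
    have : f (x, w) = (∑ i, chiMoment i f x * chi i w) - collision f (x, w) := by
      simp [collision]
    rw [show collision f (x, w) * f (x, w) = collision f (x, w) *
      ((∑ i, chiMoment i f x * chi i w) - collision f (x, w)) by rw [← this], mul_sub,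
      Finset.mul_sum]
    congr 1
    exact Finset.sum_congr rfl fun i _ => by ring
  have hi : ∀ i, Integrable (fun w => chiMoment i f x * (collision f (x, w) * chi i w)) maxwell :=
    fun i => (hC.integrable_mul (memLp_chi i)).const_mul _
  have hCC : Integrable (fun w => collision f (x, w) * collision f (x, w)) maxwell :=
    hC.integrable_mul hC
  simp only [e]
  rw [integral_sub (integrable_finsetSum _ fun i _ => hi i) hCC,
    integral_finsetSum _ fun i _ => hi i]
  simp [integral_const_mul, horth]

lemma coeFn_L1 (f : PhaseL2) : L1 f =ᵐ[phase] collision f := MemLp.coeFn_toLp _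

lemma inner_eq_integral (f g : PhaseL2) : inner ℝ f g = ∫ y, f y * g y ∂phase := by
  rw [L2.inner_def]
  simp [mul_comm]

lemma inner_L1_self (f : PhaseL2) : inner ℝ (L1 f) f = -inner ℝ (L1 f) (L1 f) := by
  have hC := memLp_collision (Lp.memLp f)
  rw [inner_eq_integral, inner_eq_integral,
    integral_congr_ae (f := fun y => L1 f y * f y) (g := fun y => collision f y * f y)
      ((coeFn_L1 f).mono fun y hy => by simp only [hy]),
    integral_congr_ae (f := fun y => L1 f y * L1 f y)
      (g := fun y => collision f y * collision f y)
      ((coeFn_L1 f).mono fun y hy => by simp only [hy])]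
  have i1 : Integrable (fun y => collision f y * f y) phase := hC.integrable_mul (Lp.memLp f)
  have i2 : Integrable (fun y => collision f y * collision f y) phase := hC.integrable_mul hC
  rw [integral_prod _ i1, integral_prod _ i2, ← integral_neg]
  refine integral_congr_ae ?_
  filter_upwards [ae_memLp_fiber (Lp.memLp f)] with x hx
  exact integral_collision_mul_fiber hx

lemma inner_L1_self_nonpos (f : PhaseL2) : inner ℝ f (L1 f) ≤ 0 := by
  rw [real_inner_comm, inner_L1_self]
  exact neg_nonpos.2 real_inner_self_nonneg

/-- Cauchy–Schwarz applied to `‖L1 f‖² = -⟨L1 f, f⟩`. -/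
lemma norm_L1_le (f : PhaseL2) : ‖L1 f‖ ≤ ‖f‖ := by
  have h1 := inner_L1_self f
  rw [real_inner_self_eq_norm_sq] at h1
  have h2 := abs_real_inner_le_norm (L1 f) f
  rw [h1, abs_neg, abs_of_nonneg (sq_nonneg _), sq] at h2
  rcases (norm_nonneg (L1 f)).eq_or_lt with h | h
  · rw [← h]; exact norm_nonneg f
  · exact le_of_mul_le_mul_left h2 h

/-- `L1` is defined through representatives; linearity needs the moments to be insensitive to their
choice. -/
lemma chiMoment_congr {f g : ℝ × ℝ → ℝ} (h : f =ᵐ[phase] g) (i : Fin 3) :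
    ∀ᵐ x, chiMoment i f x = chiMoment i g x := by
  filter_upwards [Measure.ae_ae_of_ae_prod h] with x hx
  exact integral_congr_ae (hx.mono fun w hw => by simp only [hw])

lemma ae_phase_of_ae_fst {P : ℝ → Prop} (h : ∀ᵐ x, P x) : ∀ᵐ y ∂phase, P y.1 :=
  Measure.quasiMeasurePreserving_fst.ae h

lemma L1_add (f g : PhaseL2) : L1 (f + g) = L1 f + L1 g := by
  refine Lp.ext ?_
  have hm : ∀ᵐ x, ∀ i, chiMoment i (f + g : PhaseL2) x = chiMoment i f x + chiMoment i g x := by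
    rw [ae_all_iff]
    intro i
    filter_upwards [chiMoment_congr (Lp.coeFn_add f g) i, ae_memLp_fiber (Lp.memLp f),
      ae_memLp_fiber (Lp.memLp g)] with x h1 h2 h3
    rw [h1]
    simp only [chiMoment, Pi.add_apply, mul_add]
    exact integral_add ((memLp_chi i).integrable_mul h2) ((memLp_chi i).integrable_mul h3)
  filter_upwards [coeFn_L1 (f + g), coeFn_L1 f, coeFn_L1 g, Lp.coeFn_add (L1 f) (L1 g),
    Lp.coeFn_add f g, ae_phase_of_ae_fst hm] with y h1 h2 h3 h4 h5 h6
  rw [h1, h4, Pi.add_apply, h2, h3]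
  simp only [collision, h6, h5, Pi.add_apply, add_mul, Finset.sum_add_distrib]
  ring

lemma L1_smul (c : ℝ) (f : PhaseL2) : L1 (c • f) = c • L1 f := by
  refine Lp.ext ?_
  have hm : ∀ᵐ x, ∀ i, chiMoment i (c • f : PhaseL2) x = c * chiMoment i f x := by
    rw [ae_all_iff]
    intro i
    filter_upwards [chiMoment_congr (Lp.coeFn_smul c f) i] with x h1
    rw [h1]
    simp only [chiMoment, Pi.smul_apply, smul_eq_mul, ← integral_const_mul]
    exact integral_congr_ae (Eventually.of_forall fun w => by ring)
  filter_upwards [coeFn_L1 (c • f), coeFn_L1 f, Lp.coeFn_smul c (L1 f),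
    Lp.coeFn_smul c f, ae_phase_of_ae_fst hm] with y h1 h2 h4 h5 h6
  rw [h1, h4, Pi.smul_apply, h2]
  simp only [collision, h6, h5, Pi.smul_apply, smul_eq_mul, mul_sub, Finset.mul_sum, mul_assoc]

/-- The linearized BGK operator as a bounded operator. -/
noncomputable def collisionCLM : PhaseL2 →L[ℝ] PhaseL2 :=
  LinearMap.mkContinuous ⟨⟨L1, L1_add⟩, L1_smul⟩ 1 fun f => by simpa using norm_L1_le f

end Collision

/-! ### Distributional transport and the free-streaming group -/

section Transport

/-- The density of `phase` with respect to Lebesgue measure. -/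
noncomputable def weight (y : ℝ × ℝ) : ℝ := gaussianPDFReal 0 1 y.2

lemma weight_pos (y : ℝ × ℝ) : 0 < weight y := gaussianPDFReal_pos 0 1 y.2 one_ne_zero

lemma continuous_weight : Continuous weight := by
  unfold weight gaussianPDFReal
  fun_prop

lemma phase_eq_withDensity :
    phase = (volume : Measure (ℝ × ℝ)).withDensity (fun y => gaussianPDF 0 1 y.2) := by
  rw [phase, maxwell, gaussianReal_of_var_ne_zero 0 one_ne_zero,
    prod_withDensity_right (measurable_gaussianPDF 0 1)]
  rfl

lemma phase_absolutelyContinuous : phase ≪ (volume : Measure (ℝ × ℝ)) := by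
  rw [phase_eq_withDensity]; exact withDensity_absolutelyContinuous _ _

lemma integral_phase (F : ℝ × ℝ → ℝ) : ∫ y, F y ∂phase = ∫ y, weight y * F y := by
  rw [phase_eq_withDensity, integral_withDensity_eq_integral_toReal_smul
    (f := fun y : ℝ × ℝ => gaussianPDF 0 1 y.2) ((measurable_gaussianPDF 0 1).comp measurable_snd)
    (Eventually.of_forall fun y => gaussianPDF_lt_top)]
  simp [weight, toReal_gaussianPDF]

lemma integrable_phase_iff (F : ℝ × ℝ → ℝ) :
    Integrable F phase ↔ Integrable (fun y => weight y * F y) volume := by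
  rw [phase_eq_withDensity, integrable_withDensity_iff_integrable_smul'
    (f := fun y : ℝ × ℝ => gaussianPDF 0 1 y.2) ((measurable_gaussianPDF 0 1).comp measurable_snd)
    (Eventually.of_forall fun y => gaussianPDF_lt_top)]
  simp [weight, toReal_gaussianPDF]

/-- Dividing by the nowhere vanishing weight turns the Lebesgue pairings of `IsTransport` into inner
products of `PhaseL2`. -/
lemma memLp_div_weight {φ : ℝ × ℝ → ℝ} (hφ : Continuous φ) (hs : HasCompactSupport φ) :
    MemLp (fun y => φ y / weight y) 2 phase := by
  refine Continuous.memLp_of_hasCompactSupport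
    (hφ.div continuous_weight fun y => (weight_pos y).ne') ?_
  refine hs.mono fun y hy => ?_
  simp only [Function.mem_support] at hy ⊢
  exact fun h => hy (by simp [h])

/-- The vector of `L²(M₁ dx dv)` that represents `f ↦ ∫ f φ dx dv`. -/
noncomputable def dualVec (φ : ℝ × ℝ → ℝ) (hφ : Continuous φ) (hs : HasCompactSupport φ) :
    PhaseL2 := (memLp_div_weight hφ hs).toLp _

lemma integrable_mul_test (f : PhaseL2) {φ : ℝ × ℝ → ℝ} (hφ : Continuous φ)
    (hs : HasCompactSupport φ) : Integrable (fun y => f y * φ y) volume := by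
  have h : Integrable (fun y => f y * (φ y / weight y)) phase :=
    (Lp.memLp f).integrable_mul (memLp_div_weight hφ hs)
  rw [integrable_phase_iff] at h
  refine h.congr (Eventually.of_forall fun y => ?_)
  have := (weight_pos y).ne'
  field_simp

lemma integral_mul_test (f : PhaseL2) {φ : ℝ × ℝ → ℝ} (hφ : Continuous φ)
    (hs : HasCompactSupport φ) : ∫ y, f y * φ y = inner ℝ f (dualVec φ hφ hs) := by
  rw [inner_eq_integral, integral_congr_ae (f := fun y => f y * dualVec φ hφ hs y)
    (g := fun y => f y * (φ y / weight y))
    ((MemLp.coeFn_toLp (memLp_div_weight hφ hs)).mono fun y hy => by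
      simp only [dualVec, hy]), integral_phase]
  refine integral_congr_ae (Eventually.of_forall fun y => ?_)
  have := (weight_pos y).ne'
  field_simp

lemma locallyIntegrable_coeFn (f : PhaseL2) : LocallyIntegrable f (volume : Measure (ℝ × ℝ)) := by
  rw [locallyIntegrable_iff]
  intro K hK
  obtain ⟨χ, h1, -, hs, -⟩ := exists_continuous_one_zero_of_isCompact hK isClosed_empty
    (disjoint_empty K)
  refine ((integrable_mul_test f χ.continuous hs).integrableOn (s := K)).congr ?_
  filter_upwards [ae_restrict_mem hK.measurableSet] with y hy
  simp [h1 hy]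

lemma eq_zero_of_integral_test_eq_zero {f : PhaseL2}
    (h : ∀ φ : ℝ × ℝ → ℝ, ContDiff ℝ ∞ φ → HasCompactSupport φ → ∫ y, f y * φ y = 0) : f = 0 := by
  have h0 := ae_eq_zero_of_integral_contDiff_smul_eq_zero (locallyIntegrable_coeFn f)
    fun φ hφ hs => by simpa [mul_comm] using h φ hφ hs
  refine Lp.ext ?_
  filter_upwards [phase_absolutelyContinuous.ae_le h0, Lp.coeFn_zero ℝ 2 phase] with y h1 h2
  rw [h1, h2, Pi.zero_apply]

/-- The vectors `φ / M₁` with smooth compactly supported `φ`. -/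
noncomputable def testSpace : Submodule ℝ PhaseL2 := Submodule.span ℝ
  {u | ∃ (φ : ℝ × ℝ → ℝ) (hφ : ContDiff ℝ ∞ φ) (hs : HasCompactSupport φ),
    u = dualVec φ hφ.continuous hs}

/-- The generating set is already a subspace, so the span adds nothing. -/
lemma testSpace_mem {u : PhaseL2} (hu : u ∈ testSpace) :
    ∃ (φ : ℝ × ℝ → ℝ) (hφ : ContDiff ℝ ∞ φ) (hs : HasCompactSupport φ),
      u = dualVec φ hφ.continuous hs := by
  induction hu using Submodule.span_induction with
  | mem x hx => exact hx
  | zero =>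
    refine ⟨fun _ => 0, contDiff_const, HasCompactSupport.zero, Lp.ext ?_⟩
    filter_upwards [Lp.coeFn_zero ℝ 2 phase, MemLp.coeFn_toLp (memLp_div_weight
      (contDiff_const (𝕜 := ℝ) (n := ∞) (c := (0 : ℝ))).continuous HasCompactSupport.zero)]
      with y h1 h2
    rw [h1, dualVec, h2]; simp
  | add x y _ _ hx hy =>
    obtain ⟨φ, hφ, hs, rfl⟩ := hx
    obtain ⟨ψ, hψ, hs', rfl⟩ := hy
    refine ⟨fun y => φ y + ψ y, hφ.add hψ, hs.add hs', ?_⟩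
    rw [dualVec, dualVec, dualVec, ← MemLp.toLp_add]
    congr 1
    funext y
    simp [add_div]
  | smul c x _ hx =>
    obtain ⟨φ, hφ, hs, rfl⟩ := hx
    refine ⟨fun y => c * φ y, contDiff_const.mul hφ, hs.mul_left, ?_⟩
    rw [dualVec, dualVec, ← MemLp.toLp_const_smul]
    congr 1
    funext y
    simp [mul_div_assoc]

lemma dense_testSpace : Dense (testSpace : Set PhaseL2) := by
  rw [Submodule.dense_iff_topologicalClosure_eq_top, Submodule.topologicalClosure_eq_top_iff,
    Submodule.eq_bot_iff]
  intro f hf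
  refine eq_zero_of_integral_test_eq_zero fun φ hφ hs => ?_
  rw [integral_mul_test f hφ.continuous hs, real_inner_comm]
  exact hf _ (Submodule.subset_span ⟨φ, hφ, hs, rfl⟩)

/-- Free streaming over the time `h`. -/
def shear (h : ℝ) : (ℝ × ℝ) ≃ₜ (ℝ × ℝ) where
  toFun y := (y.1 + h * y.2, y.2)
  invFun y := (y.1 - h * y.2, y.2)
  left_inv y := by simp
  right_inv y := by simp
  continuous_toFun := by fun_prop
  continuous_invFun := by fun_prop

lemma shear_apply (h : ℝ) (y : ℝ × ℝ) : shear h y = (y.1 + h * y.2, y.2) := rfl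

lemma shear_shear (h k : ℝ) (y : ℝ × ℝ) : shear h (shear k y) = shear (h + k) y := by
  simp [shear_apply]; ring

/-- For fixed `v` the shear is a translation in `x`; the swaps put `v` first, as a skew product
requires. -/
lemma measurePreserving_shear (h : ℝ) : MeasurePreserving (shear h) phase phase := by
  have h1 : MeasurePreserving (fun p : ℝ × ℝ => (p.1, p.2 + h * p.1))
      (maxwell.prod volume) (maxwell.prod volume) :=
    (MeasurePreserving.id maxwell).skew_product (g := fun v x => x + h * v) (by fun_prop)
      (Eventually.of_forall fun v => (measurePreserving_add_right volume (h * v)).map_eq)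
  exact (Measure.measurePreserving_swap.comp h1).comp Measure.measurePreserving_swap

/-- Free streaming on `L²(M₁ dx dv)`. -/
noncomputable def stream (h : ℝ) : PhaseL2 →ₗᵢ[ℝ] PhaseL2 :=
  Lp.compMeasurePreservingₗᵢ ℝ (shear h) (measurePreserving_shear h)

lemma stream_zero (f : PhaseL2) : stream 0 f = f := by
  refine Lp.ext ((Lp.coeFn_compMeasurePreserving f (measurePreserving_shear 0)).trans
    (Eventually.of_forall fun y => ?_))
  simp [shear_apply]

lemma coeFn_stream (h : ℝ) (f : PhaseL2) : stream h f =ᵐ[phase] f ∘ shear h :=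
  Lp.coeFn_compMeasurePreserving f (measurePreserving_shear h)

lemma hasCompactSupport_comp_shear {φ : ℝ × ℝ → ℝ} (hs : HasCompactSupport φ) (h : ℝ) :
    HasCompactSupport fun y => φ (shear h y) :=
  hs.comp_homeomorph (shear h)

lemma contDiff_shear (h : ℝ) : ContDiff ℝ ∞ (shear h) := by
  change ContDiff ℝ ∞ fun y : ℝ × ℝ => (y.1 + h * y.2, y.2)
  fun_prop

/-- The shear moves onto the test function, because the weight depends on `v` only and is invariant.
Later only `φ` has to be differentiated. -/
lemma inner_stream_dualVec (h : ℝ) (f : PhaseL2) {φ : ℝ × ℝ → ℝ} (hφ : Continuous φ)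
    (hs : HasCompactSupport φ) :
    inner ℝ (stream h f) (dualVec φ hφ hs) = ∫ y, f y * φ (shear (-h) y) := by
  have hφ' : Continuous fun y => φ (shear (-h) y) := hφ.comp (shear (-h)).continuous
  have e : ∀ y, shear (-h) (shear h y) = y := fun y => by simp [shear_apply]
  have ew : ∀ y, weight (shear h y) = weight y := fun y => rfl
  rw [integral_mul_test f hφ' (hasCompactSupport_comp_shear hs _), inner_eq_integral,
    inner_eq_integral,
    integral_congr_ae (f := fun y => stream h f y * dualVec φ hφ hs y)
    (g := fun y => f (shear h y) * (φ (shear (-h) (shear h y)) / weight (shear h y)))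
    (by
      filter_upwards [coeFn_stream h f, MemLp.coeFn_toLp (memLp_div_weight hφ hs)] with y h1 h2
      rw [h1, dualVec, h2, e, ew]; rfl),
    (measurePreserving_shear h).integral_comp (shear h).measurableEmbedding
      (fun y => f y * (φ (shear (-h) y) / weight y))]
  refine integral_congr_ae ?_
  filter_upwards [MemLp.coeFn_toLp (memLp_div_weight hφ' (hasCompactSupport_comp_shear hs _))]
    with y h2
  rw [dualVec, h2]

lemma hasDerivAt_comp_shear {φ : ℝ × ℝ → ℝ} (hφ : ContDiff ℝ ∞ φ) (y : ℝ × ℝ) (s : ℝ) :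
    HasDerivAt (fun s => φ (shear (-s) y))
      (-(y.2 * fderiv ℝ φ (shear (-s) y) (1, 0))) s := by
  have h1 : HasDerivAt (fun s => shear (-s) y) (-y.2, 0) s := by
    change HasDerivAt (fun s => (y.1 + -s * y.2, y.2)) (-y.2, 0) s
    refine HasDerivAt.prodMk ?_ (hasDerivAt_const _ _)
    simpa using ((hasDerivAt_id s).neg.mul_const y.2).const_add y.1
  have h2 := ((hφ.differentiable (by simp)).differentiableAt (x := shear (-s) y)).hasFDerivAt
  refine (h2.comp_hasDerivAt s h1).congr_deriv ?_
  rw [show ((-y.2, 0) : ℝ × ℝ) = (-y.2) • (1, 0) by simp, map_smul]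
  simp

lemma hasDerivAt_integral_comp_shear {f g : PhaseL2} (hfg : IsTransport f g) {φ : ℝ × ℝ → ℝ}
    (hφ : ContDiff ℝ ∞ φ) (hs : HasCompactSupport φ) :
    HasDerivAt (fun s => ∫ y, f y * φ (shear (-s) y)) (∫ y, g y * φ y) 0 := by
  set η : ℝ × ℝ → ℝ := fun y => y.2 * fderiv ℝ φ y (1, 0) with hη
  have hηc : Continuous η := continuous_snd.mul
    ((hφ.continuous_fderiv (by simp)).clm_apply continuous_const)
  have hηs : HasCompactSupport η := by
    refine (hs.fderiv (𝕜 := ℝ)).mono fun y hy => ?_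
    simp only [Function.mem_support] at hy ⊢
    exact fun h => hy (by simp [hη, h])
  obtain ⟨C, hC⟩ := hηs.exists_bound_of_continuous hηc
  -- One compact set carries `η ∘ shear (-s)` for all `|s| ≤ 1`, which yields an integrable
  -- dominating function.
  set K : Set (ℝ × ℝ) := (fun p : ℝ × (ℝ × ℝ) => shear p.1 p.2) '' (Icc (-1) 1 ×ˢ tsupport η)
  have hK : IsCompact K := by
    refine (isCompact_Icc.prod hηs).image ?_
    change Continuous fun p : ℝ × (ℝ × ℝ) => (p.2.1 + p.1 * p.2.2, p.2.2)
    fun_prop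
  have hbd : ∀ y, ∀ s ∈ Ioo (-1 : ℝ) 1, ‖f y * -η (shear (-s) y)‖ ≤
      K.indicator (fun y => C * ‖f y‖) y := by
    intro y s hs1
    by_cases hy : y ∈ K
    · rw [indicator_of_mem hy, norm_mul, norm_neg, mul_comm]
      gcongr
      exact hC _
    · have : η (shear (-s) y) = 0 := by
        by_contra h0
        refine hy ⟨(s, shear (-s) y), ⟨⟨hs1.1.le, hs1.2.le⟩, subset_tsupport _ h0⟩, ?_⟩
        simp [shear_apply]
      simp [this, hy]
  have hci : ∀ s, Integrable (fun y => f y * φ (shear (-s) y)) volume := fun s =>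
    integrable_mul_test f (hφ.continuous.comp (shear (-s)).continuous)
      (hasCompactSupport_comp_shear hs _)
  have h := (hasDerivAt_integral_of_dominated_loc_of_deriv_le (μ := (volume : Measure (ℝ × ℝ)))
    (F := fun s y => f y * φ (shear (-s) y)) (F' := fun s y => f y * -η (shear (-s) y))
    (x₀ := 0) (bound := K.indicator (fun y => C * ‖f y‖)) (s := Ioo (-1) 1)
    (Ioo_mem_nhds (by norm_num) (by norm_num))
    (Eventually.of_forall fun s => (hci s).aestronglyMeasurable) (hci 0)
    ((locallyIntegrable_coeFn f).aestronglyMeasurable.mul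
      (hηc.comp (shear (-0)).continuous).neg.aestronglyMeasurable)
    (Eventually.of_forall hbd)
    (IntegrableOn.integrable_indicator
      (((locallyIntegrable_coeFn f).integrableOn_isCompact hK).norm.const_mul C) hK.measurableSet)
    (Eventually.of_forall fun y s _ => (hasDerivAt_comp_shear hφ y s).const_mul (f y))).2
  refine h.congr_deriv ?_
  have e : ∀ y : ℝ × ℝ, shear (-0) y = y := fun y => by simp [shear_apply]
  simp only [e, mul_neg, integral_neg]
  rw [hfg φ hφ hs, neg_neg]

/-- By the group law, this is the derivative at time zero tested against `φ ∘ shear (-h)`. -/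
lemma hasDerivAt_inner_stream {f g : PhaseL2} (hfg : IsTransport f g) {φ : ℝ × ℝ → ℝ}
    (hφ : ContDiff ℝ ∞ φ) (hs : HasCompactSupport φ) (h : ℝ) :
    HasDerivAt (fun s => inner ℝ (stream s f) (dualVec φ hφ.continuous hs))
      (inner ℝ (stream h g) (dualVec φ hφ.continuous hs)) h := by
  simp only [inner_stream_dualVec]
  have h1 := hasDerivAt_integral_comp_shear hfg (hφ.comp (contDiff_shear (-h)))
    (hasCompactSupport_comp_shear hs (-h))
  have h2 : HasDerivAt (fun s : ℝ => s - h) 1 h := (hasDerivAt_id h).sub_const h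
  rw [← sub_self h] at h1
  have h3 := h1.comp_of_eq h h2 rfl
  refine (h3.congr_deriv (by simp)).congr_of_eventuallyEq (Eventually.of_forall fun s => ?_)
  simp only [Function.comp_apply, shear_shear]
  congr! 6
  ring

/-- The mean value inequality, with `stream` isometric, bounds the pairing with each test vector;
density then allows pairing with the difference itself. -/
lemma norm_stream_sub_le {f g : PhaseL2} (hfg : IsTransport f g) (h : ℝ) :
    ‖stream h f - f‖ ≤ |h| * ‖g‖ := by
  have key : ∀ u ∈ testSpace, |inner ℝ (stream h f - f) u| ≤ |h| * ‖g‖ * ‖u‖ := by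
    intro u hu
    obtain ⟨φ, hφ, hs, rfl⟩ := testSpace_mem hu
    set u := dualVec φ hφ.continuous hs
    have := convex_univ.norm_image_sub_le_of_norm_hasDerivWithin_le
      (f := fun s => inner ℝ (stream s f) u) (f' := fun s => inner ℝ (stream s g) u)
      (C := ‖g‖ * ‖u‖) (fun s _ => (hasDerivAt_inner_stream hfg hφ hs s).hasDerivWithinAt)
      (fun s _ => by simpa using norm_inner_le_norm (𝕜 := ℝ) (stream s g) u)
      (mem_univ 0) (mem_univ h)
    rw [stream_zero, ← inner_sub_left, Real.norm_eq_abs, Real.norm_eq_abs, sub_zero] at this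
    linarith
  have hall : ∀ u, |inner ℝ (stream h f - f) u| ≤ |h| * ‖g‖ * ‖u‖ := fun u =>
    closure_minimal (s := (testSpace : Set PhaseL2))
      (t := {u | |inner ℝ (stream h f - f) u| ≤ |h| * ‖g‖ * ‖u‖}) key
      (isClosed_le (by fun_prop) (by fun_prop)) (dense_testSpace u)
  have h1 := hall (stream h f - f)
  rw [real_inner_self_eq_norm_sq, abs_of_nonneg (sq_nonneg _), sq] at h1
  rcases (norm_nonneg (stream h f - f)).eq_or_lt with h2 | h2
  · rw [← h2]; positivity
  · exact le_of_mul_le_mul_right h1 h2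

/-- Transport is skew-symmetric on its maximal domain. -/
theorem IsTransport.inner_eq_zero {f g : PhaseL2} (hfg : IsTransport f g) : inner ℝ f g = 0 := by
  -- Isometry gives `⟨stream s f, f⟩ - ‖f‖² = -‖stream s f - f‖² / 2`, which is `O(s²)`.
  have hself : HasDerivAt (fun s => inner ℝ (stream s f) f) 0 0 := by
    have hO : (fun s => inner ℝ (stream s f) f - inner ℝ (stream 0 f) f) =O[𝓝 0]
        fun s : ℝ => (s - 0) ^ 2 := by
      refine Asymptotics.IsBigO.of_bound (‖g‖ ^ 2 / 2) (Eventually.of_forall fun s => ?_)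
      have h1 := norm_stream_sub_le hfg s
      have h2 := norm_sub_sq_real (stream s f) f
      rw [LinearIsometry.norm_map] at h2
      rw [stream_zero, real_inner_self_eq_norm_sq,
        show inner ℝ (stream s f) f - ‖f‖ ^ 2 = -(‖stream s f - f‖ ^ 2 / 2) by linarith,
        norm_neg, Real.norm_of_nonneg (by positivity), sub_zero, norm_pow, Real.norm_eq_abs]
      have h3 := pow_le_pow_left₀ (norm_nonneg _) h1 2
      rw [mul_pow] at h3
      linarith
    rw [hasDerivAt_iff_isLittleO]
    simp only [smul_zero, sub_zero] at hO ⊢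
    exact hO.trans_isLittleO (by simpa using Asymptotics.isLittleO_pow_id (𝕜 := ℝ) one_lt_two)
  -- `⟨g, u⟩` is the derivative at zero of `⟨stream s f, u - f⟩`, whose increments are at most `|s|
  -- ‖g‖ ‖f - u‖`. By density `u` may then be replaced by `f`.
  have key : ∀ u ∈ testSpace, |inner ℝ g u| ≤ ‖g‖ * ‖f - u‖ := by
    intro u hu
    obtain ⟨φ, hφ, hs, rfl⟩ := testSpace_mem hu
    have hd := (hasDerivAt_inner_stream hfg hφ hs 0).sub hself
    rw [stream_zero, sub_zero] at hd
    set u := dualVec φ hφ.continuous hs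
    refine hd.le_of_lip' (by positivity) (Eventually.of_forall fun s => ?_)
    have e : ((fun s => inner ℝ (stream s f) u) - fun s => inner ℝ (stream s f) f) s -
        ((fun s => inner ℝ (stream s f) u) - fun s => inner ℝ (stream s f) f) 0 =
        -inner ℝ (stream s f - f) (f - u) := by
      simp only [Pi.sub_apply, stream_zero, inner_sub_left, inner_sub_right]; ring
    rw [e, norm_neg, sub_zero]
    refine (norm_inner_le_norm (𝕜 := ℝ) _ _).trans ?_
    refine (mul_le_mul_of_nonneg_right (norm_stream_sub_le hfg s) (norm_nonneg _)).trans_eq ?_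
    rw [Real.norm_eq_abs]; ring
  have h : |inner ℝ g f| ≤ ‖g‖ * ‖f - f‖ :=
    closure_minimal (s := (testSpace : Set PhaseL2))
      (t := {u | |inner ℝ g u| ≤ ‖g‖ * ‖f - u‖}) key
      (isClosed_le (by fun_prop) (by fun_prop)) (dense_testSpace f)
  rw [real_inner_comm]
  simpa using h

/-- The functionals whose common kernel is the graph of the transport operator. -/
lemma exists_transport_functionals {φ : ℝ × ℝ → ℝ} (hφ : ContDiff ℝ ∞ φ)
    (hs : HasCompactSupport φ) : ∃ a b : PhaseL2, ∀ u : PhaseL2,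
      ∫ y : ℝ × ℝ, u y * (y.2 * fderiv ℝ φ y (1, 0)) = inner ℝ a u ∧
        ∫ y : ℝ × ℝ, u y * φ y = inner ℝ b u := by
  have hηc : Continuous fun y : ℝ × ℝ => y.2 * fderiv ℝ φ y (1, 0) := continuous_snd.mul
    ((hφ.continuous_fderiv (by simp)).clm_apply continuous_const)
  have hηs : HasCompactSupport fun y : ℝ × ℝ => y.2 * fderiv ℝ φ y (1, 0) := by
    refine (hs.fderiv (𝕜 := ℝ)).mono fun y hy => ?_
    simp only [Function.mem_support] at hy ⊢
    exact fun h => hy (by simp [h])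
  refine ⟨dualVec _ hηc hηs, dualVec _ hφ.continuous hs, fun u => ⟨?_, ?_⟩⟩
  · rw [integral_mul_test u hηc hηs, real_inner_comm]
  · rw [integral_mul_test u hφ.continuous hs, real_inner_comm]

lemma IsTransport.sub {f g f' g' : PhaseL2} (h : IsTransport f g) (h' : IsTransport f' g') :
    IsTransport (f - f') (g - g') := by
  intro φ hφ hs
  obtain ⟨a, b, hab⟩ := exists_transport_functionals hφ hs
  have h1 := h φ hφ hs
  have h2 := h' φ hφ hs
  rw [(hab _).1, (hab _).2] at h1 h2 ⊢
  rw [inner_sub_right, inner_sub_right, h1, h2]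
  ring

lemma IsTransport.smul {f g : PhaseL2} (h : IsTransport f g) (c : ℝ) :
    IsTransport (c • f) (c • g) := by
  intro φ hφ hs
  obtain ⟨a, b, hab⟩ := exists_transport_functionals hφ hs
  have h1 := h φ hφ hs
  rw [(hab _).1, (hab _).2] at h1 ⊢
  rw [inner_smul_right, inner_smul_right, h1, mul_neg]

lemma IsTransport.unique {f g g' : PhaseL2} (h : IsTransport f g) (h' : IsTransport f g') :
    g = g' := by
  have h0 := h.sub h'
  refine sub_eq_zero.1 (eq_zero_of_integral_test_eq_zero fun φ hφ hs => ?_)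
  obtain ⟨a, b, hab⟩ := exists_transport_functionals hφ hs
  have h1 := h0 φ hφ hs
  rw [sub_self, (hab 0).1, inner_zero_right] at h1
  exact neg_eq_zero.1 h1.symm

/-- Time derivatives preserve the transport relation. -/
lemma isTransport_of_hasDerivWithinAt {f g : ℝ → PhaseL2} {f' g' : PhaseL2} {s : Set ℝ} {t : ℝ}
    (hs : UniqueDiffWithinAt ℝ s t) (ht : t ∈ s) (h : ∀ r ∈ s, IsTransport (f r) (g r))
    (hf : HasDerivWithinAt f f' s t) (hg : HasDerivWithinAt g g' s t) : IsTransport f' g' := by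
  intro φ hφ hsupp
  obtain ⟨a, b, hab⟩ := exists_transport_functionals hφ hsupp
  rw [(hab _).1, (hab _).2]
  have h1 : HasDerivWithinAt (fun r => inner ℝ a (f r)) (inner ℝ a f') s t :=
    (innerSL ℝ a).hasFDerivAt.comp_hasDerivWithinAt t hf
  have h2 : HasDerivWithinAt (fun r => -inner ℝ b (g r)) (-inner ℝ b g') s t :=
    ((innerSL ℝ b).hasFDerivAt.comp_hasDerivWithinAt t hg).neg
  have e : ∀ r ∈ s, inner ℝ a (f r) = -inner ℝ b (g r) := fun r hr => by
    have := h r hr φ hφ hsupp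
    rwa [(hab _).1, (hab _).2] at this
  exact hs.eq_deriv _ h1 (h2.congr e (e t ht))

end Transport

/-! ### Polynomial growth from energy estimates -/

section Growth

variable {E : Type*} [NormedAddCommGroup E]

/-- `limsup ‖u t‖ / t ^ k ≤ A` as `t → ∞`. -/
def GrowsLike (A : ℝ) (k : ℕ) (u : ℝ → E) : Prop :=
  ∀ C, A < C → ∀ᶠ t in atTop, ‖u t‖ ≤ C * t ^ k

lemma GrowsLike.of_norm_le {A : ℝ} {k : ℕ} {u : ℝ → E} {f : ℝ → ℝ} (hf : GrowsLike A k f)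
    (h : ∀ t, 0 ≤ t → ‖u t‖ ≤ f t) : GrowsLike A k u := fun C hC => by
  filter_upwards [hf C hC, eventually_ge_atTop 0] with t h1 h2
  exact (h t h2).trans ((Real.le_norm_self _).trans h1)

lemma GrowsLike.norm {A : ℝ} {k : ℕ} {u : ℝ → E} (hu : GrowsLike A k u) :
    GrowsLike A k fun t => ‖u t‖ := by simpa [GrowsLike] using hu

lemma GrowsLike.mono {A A' : ℝ} {k k' : ℕ} {u : ℝ → E} (hu : GrowsLike A k u) (hA : 0 ≤ A)
    (hAA : A ≤ A') (hk : k ≤ k') : GrowsLike A' k' u := fun C hC => by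
  filter_upwards [hu C (hAA.trans_lt hC), eventually_ge_atTop 1] with t h1 h2
  exact h1.trans (mul_le_mul_of_nonneg_left (pow_le_pow_right₀ h2 hk) (hA.trans (hAA.trans hC.le)))

lemma GrowsLike.add {A A' : ℝ} {k : ℕ} {u u' : ℝ → E} (hu : GrowsLike A k u)
    (hu' : GrowsLike A' k u') : GrowsLike (A + A') k fun t => u t + u' t := fun C hC => by
  filter_upwards [hu (A + (C - (A + A')) / 2) (by linarith),
    hu' (A' + (C - (A + A')) / 2) (by linarith)] with t h1 h2
  refine (norm_add_le_of_le h1 h2).trans_eq ?_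
  ring

lemma growsLike_zero (k : ℕ) : GrowsLike 0 k fun _ => (0 : E) := fun C hC => by
  filter_upwards [eventually_ge_atTop 0] with t ht
  simp only [norm_zero]; positivity

lemma GrowsLike.sum {ι : Type*} (s : Finset ι) {A : ι → ℝ} {k : ℕ} {u : ι → ℝ → E}
    (hu : ∀ i ∈ s, GrowsLike (A i) k (u i)) :
    GrowsLike (∑ i ∈ s, A i) k fun t => ∑ i ∈ s, u i t := by
  classical
  induction s using Finset.induction_on with
  | empty => simpa using growsLike_zero k
  | insert a s ha ih =>
    simp only [Finset.sum_insert ha]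
    exact (hu a (by simp)).add (ih fun i hi => hu i (by simp [hi]))

lemma GrowsLike.const_mul {A b : ℝ} {k : ℕ} {u : ℝ → ℝ} (hu : GrowsLike A k u) (hb : 0 ≤ b) :
    GrowsLike (b * A) k fun t => b * u t := by
  rcases hb.eq_or_lt with rfl | hb'
  · simpa using growsLike_zero k
  intro C hC
  filter_upwards [hu (C / b) (by rwa [lt_div_iff₀ hb', mul_comm])] with t h1
  rw [norm_mul, Real.norm_of_nonneg hb]
  calc b * ‖u t‖ ≤ b * (C / b * t ^ k) := by gcongr
    _ = C * t ^ k := by field_simp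

variable [InnerProductSpace ℝ E]

lemma norm_le_norm_zero_of_inner_deriv_nonpos {u u' : ℝ → E}
    (hu : ∀ t, 0 ≤ t → HasDerivWithinAt u (u' t) (Ici 0) t)
    (h : ∀ t, 0 ≤ t → inner ℝ (u t) (u' t) ≤ 0) {t : ℝ} (ht : 0 ≤ t) : ‖u t‖ ≤ ‖u 0‖ := by
  have hd : ∀ t, 0 ≤ t →
      HasDerivWithinAt (fun t => ‖u t‖ ^ 2) (2 * inner ℝ (u t) (u' t)) (Ici 0) t :=
    fun t ht => (hu t ht).norm_sq
  have := antitoneOn_of_hasDerivWithinAt_nonpos (convex_Ici (0 : ℝ))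
    (fun t ht => (hd t ht).continuousWithinAt)
    (fun t ht => (hd t (interior_subset ht)).mono interior_subset)
    (fun t ht => by have := h t (interior_subset ht); linarith)
  exact (sq_le_sq₀ (norm_nonneg _) (norm_nonneg _)).1 (this self_mem_Ici ht ht)

/-- The regularization `√(‖u‖² + 1)` stays differentiable where `u` vanishes. Its derivative is at
most `C t^k`, which is dominated by that of `C t^(k+1)`. -/
lemma norm_le_add_pow_of_inner_deriv_le {u u' : ℝ → E} {C t₀ : ℝ} {k : ℕ} (hC : 0 ≤ C)
    (ht₀ : 0 ≤ t₀) (hu : ∀ t, t₀ ≤ t → HasDerivWithinAt u (u' t) (Ici t₀) t)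
    (h : ∀ t, t₀ ≤ t → inner ℝ (u t) (u' t) ≤ ‖u t‖ * (C * t ^ k)) {t : ℝ} (ht : t₀ ≤ t) :
    ‖u t‖ ≤ √(‖u t₀‖ ^ 2 + 1) + C * t ^ (k + 1) := by
  have hpos : ∀ t, 0 < ‖u t‖ ^ 2 + 1 := fun t => by positivity
  have hd : ∀ t, t₀ ≤ t → HasDerivWithinAt (fun t => √(‖u t‖ ^ 2 + 1) - C * t ^ (k + 1))
      (2 * inner ℝ (u t) (u' t) / (2 * √(‖u t‖ ^ 2 + 1)) - C * ((k + 1 : ℕ) * t ^ k))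
      (Ici t₀) t := fun t ht =>
    (((hu t ht).norm_sq.add_const 1).sqrt (hpos t).ne').sub
      ((hasDerivAt_pow (k + 1) t).const_mul C).hasDerivWithinAt
  have hanti := antitoneOn_of_hasDerivWithinAt_nonpos (convex_Ici t₀)
    (fun t ht => (hd t ht).continuousWithinAt)
    (fun t ht => (hd t (interior_subset ht)).mono interior_subset)
    (fun t ht => by
      have ht' : t₀ ≤ t := interior_subset ht
      have htk : 0 ≤ C * t ^ k := mul_nonneg hC (pow_nonneg (ht₀.trans ht') k)
      have h1 : ‖u t‖ ≤ √(‖u t‖ ^ 2 + 1) := Real.le_sqrt_of_sq_le (by linarith)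
      have h2 : inner ℝ (u t) (u' t) / √(‖u t‖ ^ 2 + 1) ≤ C * t ^ k := by
        rw [div_le_iff₀ (Real.sqrt_pos.2 (hpos t)), mul_comm]
        exact (h t ht').trans (mul_le_mul_of_nonneg_right h1 htk)
      rw [mul_div_mul_left _ _ two_ne_zero]
      push_cast
      have : 0 ≤ C * t ^ k * k := mul_nonneg htk k.cast_nonneg
      linarith)
  have h1 := hanti self_mem_Ici ht ht
  have h2 : 0 ≤ C * t₀ ^ (k + 1) := by positivity
  have h3 : ‖u t‖ ≤ √(‖u t‖ ^ 2 + 1) := Real.le_sqrt_of_sq_le (by linarith)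
  simp only at h1
  linarith

lemma GrowsLike.of_inner_deriv_le {u u' : ℝ → E} {S : ℝ → ℝ} {A : ℝ} {k : ℕ} (hA : 0 ≤ A)
    (hS : GrowsLike A k S) (hu : ∀ t, 0 ≤ t → HasDerivWithinAt u (u' t) (Ici 0) t)
    (h : ∀ t, 0 ≤ t → inner ℝ (u t) (u' t) ≤ ‖u t‖ * S t) : GrowsLike A (k + 1) u := by
  intro C hC
  -- Half of the gap `C - A` serves the source; the other half absorbs the value at `t₀`, so that
  -- initial data leave no trace in the constant.
  obtain ⟨t₁, ht₁⟩ := eventually_atTop.1 (hS ((A + C) / 2) (by linarith))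
  set t₀ := max t₁ 0
  have ht₀ : 0 ≤ t₀ := le_max_right _ _
  have hb : ∀ t, t₀ ≤ t → ‖u t‖ ≤ √(‖u t₀‖ ^ 2 + 1) + (A + C) / 2 * t ^ (k + 1) := fun t ht =>
    norm_le_add_pow_of_inner_deriv_le (by linarith) ht₀
      (fun s hs => (hu s (ht₀.trans hs)).mono (Ici_subset_Ici.2 ht₀))
      (fun s hs => (h s (ht₀.trans hs)).trans (mul_le_mul_of_nonneg_left
        ((Real.le_norm_self _).trans (ht₁ s ((le_max_left _ _).trans hs))) (norm_nonneg _))) ht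
  have hlim : Tendsto (fun t : ℝ => (C - A) / 2 * t ^ (k + 1)) atTop atTop :=
    (tendsto_pow_atTop k.succ_ne_zero).const_mul_atTop (by linarith)
  filter_upwards [hlim.eventually_ge_atTop (√(‖u t₀‖ ^ 2 + 1)), eventually_ge_atTop t₀]
    with t h1 h2
  have := hb t h2
  linarith

/-- Growth of the solutions of a triangular hierarchy of dissipative equations, in which the
coupling terms can be eliminated by means of the equations. -/
theorem growsLike_of_hierarchy {L : E → E} (hLn : ∀ f, ‖L f‖ ≤ ‖f‖)
    (hLd : ∀ f, inner ℝ f (L f) ≤ 0) {N : ℕ} {b : ℝ} (hb : 0 ≤ b) {β : ℕ → ℕ → ℝ}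
    (hβ : ∀ k ≤ N, ∀ j < k, |β k j| ≤ b) {Q W : ℕ → ℕ → ℝ → E}
    (hQ : ∀ k l, k + l ≤ N → ∀ t, 0 ≤ t → HasDerivWithinAt (Q k l) (Q k (l + 1) t) (Ici 0) t)
    (hW : ∀ k l, k + l ≤ N → ∀ t, 0 ≤ t →
      Q k (l + 1) t + W k l t + ∑ j ∈ Finset.range k, β k j • W j l t = L (Q k l t))
    (horth : ∀ k l, k + l ≤ N → ∀ t, 0 ≤ t → inner ℝ (Q k l t) (W k l t) = 0)
    {D : ℝ} (hD : 0 ≤ D) (hQ0 : ∀ l ≤ N, ‖Q 0 l 0‖ ≤ D) (k : ℕ) :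
    (∀ l, k + l ≤ N → GrowsLike (2 * (1 + 3 * b) ^ k * D) k (Q k l)) ∧
      ∀ l, k + l < N → GrowsLike (2 * (1 + 3 * b) ^ k * D) k (W k l) := by
  induction k using Nat.strong_induction_on with
  | _ k ih =>
  have hcoup : ∀ l t, k + l ≤ N →
      ‖∑ j ∈ Finset.range k, β k j • W j l t‖ ≤ ∑ j ∈ Finset.range k, b * ‖W j l t‖ :=
    fun l t hkl => norm_sum_le_of_le _ fun j hj => by
      rw [norm_smul]
      exact mul_le_mul_of_nonneg_right (hβ k (by omega) j (Finset.mem_range.1 hj)) (norm_nonneg _)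
  -- For `k ≥ 1` both `Q` terms and the coupling contribute `σ` each to the bound of `W k l`; the
  -- ratio `1 + 3b` makes `3σ` a telescoping geometric sum. The factor `2` covers level zero, where
  -- two terms are bounded by `D`.
  have hsum : 3 * ∑ j ∈ Finset.range k, b * (2 * (1 + 3 * b) ^ j * D) =
      2 * ((1 + 3 * b) ^ k - 1) * D := by
    have h := geom_sum_mul (1 + 3 * b) k
    rw [show ∑ j ∈ Finset.range k, b * (2 * (1 + 3 * b) ^ j * D) =
      (∑ j ∈ Finset.range k, (1 + 3 * b) ^ j) * (2 * b * D) by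
        rw [Finset.sum_mul]; exact Finset.sum_congr rfl fun j _ => by ring]
    linear_combination 2 * D * h
  set σ := ∑ j ∈ Finset.range k, b * (2 * (1 + 3 * b) ^ j * D) with hσ
  have hσ0 : 0 ≤ σ := Finset.sum_nonneg fun j _ => by positivity
  have henergy : ∀ l, k + l ≤ N → ∀ t, 0 ≤ t → inner ℝ (Q k l t) (Q k (l + 1) t) ≤
      ‖Q k l t‖ * ∑ j ∈ Finset.range k, b * ‖W j l t‖ := by
    intro l hkl t ht
    have e : Q k (l + 1) t = L (Q k l t) - W k l t - ∑ j ∈ Finset.range k, β k j • W j l t := by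
      rw [← hW k l hkl t ht]; abel
    rw [e, inner_sub_right, inner_sub_right, horth k l hkl t ht]
    have h1 := hLd (Q k l t)
    have h2 := (abs_le.1 (abs_real_inner_le_norm (Q k l t)
      (∑ j ∈ Finset.range k, β k j • W j l t))).1
    have h3 := mul_le_mul_of_nonneg_left (hcoup l t hkl) (norm_nonneg (Q k l t))
    linarith
  -- Level zero has no source, so its norm does not increase. At higher levels the sources grow at
  -- most like `t^(k-1)`; from `j < k` follows `j + l < N`, the range in which `W j l` is
  -- controlled.
  have hgrowQ : ∀ l, k + l ≤ N → GrowsLike (if k = 0 then D else σ) k (Q k l) := by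
    intro l hkl
    rcases Nat.eq_zero_or_pos k with rfl | hk
    · intro C hC
      filter_upwards [eventually_ge_atTop 0] with t ht
      have h1 := norm_le_norm_zero_of_inner_deriv_nonpos (hQ 0 l hkl)
        (fun t ht => by simpa using henergy l hkl t ht) ht
      have h2 := hQ0 l (by omega)
      simp only [if_true] at hC
      simp only [pow_zero, mul_one]
      linarith
    · obtain ⟨k, rfl⟩ : ∃ k', k = k' + 1 := ⟨k - 1, by omega⟩
      rw [if_neg (by omega)]
      refine GrowsLike.of_inner_deriv_le hσ0 (GrowsLike.sum _ fun j hj => ?_) (hQ _ l hkl)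
        (henergy l hkl)
      have hj' := Finset.mem_range.1 hj
      exact (((ih j hj').2 l (by omega)).norm.mono (by positivity) le_rfl (by omega)).const_mul hb
  have hbase : (if k = 0 then D else σ) + (if k = 0 then D else σ) + σ ≤
      2 * (1 + 3 * b) ^ k * D := by
    split_ifs with hk
    · subst hk
      simp only [hσ, Finset.range_zero, Finset.sum_empty, pow_zero]
      linarith
    · nlinarith
  have hif : 0 ≤ if k = 0 then D else σ := by split_ifs <;> assumption
  refine ⟨fun l hkl => (hgrowQ l hkl).mono hif (by linarith) le_rfl, fun l hkl => ?_⟩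
  have hS : GrowsLike σ k fun t => ∑ j ∈ Finset.range k, b * ‖W j l t‖ :=
    GrowsLike.sum _ fun j hj => by
      have hj' := Finset.mem_range.1 hj
      exact (((ih j hj').2 l (by omega)).norm.mono (by positivity) le_rfl hj'.le).const_mul hb
  refine GrowsLike.mono ?_ (by linarith) hbase le_rfl
  refine (((hgrowQ l hkl.le).norm.add (hgrowQ (l + 1) (by omega)).norm).add hS).of_norm_le ?_
  intro t ht
  -- Here `Q k (l + 1)` must itself be controlled, whence the strict inequality `k + l < N` for `W`.
  have e : W k l t = L (Q k l t) - Q k (l + 1) t - ∑ j ∈ Finset.range k, β k j • W j l t := by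
    rw [← hW k l hkl.le t ht]; abel
  rw [e]
  refine (norm_sub_le_of_le (norm_sub_le_of_le (hLn _) le_rfl) (hcoup l t hkl.le))

end Growth

/-! ### Solving the triangular system for the transport terms -/

section Hierarchy

variable {E : Type*} [NormedAddCommGroup E] [NormedSpace ℝ E]

/-- The solution `W` of `W k + ∑_{j < k} β k j • W j = X k`. -/
def solveTri (β : ℕ → ℕ → ℝ) (X : ℕ → E) (k : ℕ) : E :=
  X k - ∑ j : Fin k, β k j • solveTri β X j
termination_by k
decreasing_by exact j.2

lemma solveTri_add_sum (β : ℕ → ℕ → ℝ) (X : ℕ → E) (k : ℕ) :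
    solveTri β X k + ∑ j ∈ Finset.range k, β k j • solveTri β X j = X k := by
  rw [solveTri, Finset.sum_range]
  exact sub_add_cancel _ _

lemma hasDerivWithinAt_solveTri {β : ℕ → ℕ → ℝ} {X : ℕ → ℝ → E} {X' : ℕ → E} {s : Set ℝ} {t : ℝ}
    (k : ℕ) (hX : ∀ j ≤ k, HasDerivWithinAt (X j) (X' j) s t) :
    HasDerivWithinAt (fun r => solveTri β (fun j => X j r) k)
      (solveTri β X' k) s t := by
  induction k using Nat.strong_induction_on with
  | _ k ih =>
  simp only [solveTri.eq_def β _ k]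
  exact (hX k le_rfl).sub (HasDerivWithinAt.fun_sum fun j _ =>
    (ih j j.2 fun i hi => hX i (hi.trans j.2.le)).const_smul _)

end Hierarchy

/-! ### The time-differentiated hierarchy of a solution -/

section Solution

variable {n : ℕ} {Z : Set ℝ} {T : ℝ → ℝ} {p : ℝ → ℝ → PhaseL2}

/-- `∂ₜ^l q⁽ᵏ⁾`. -/
noncomputable def qDeriv (p : ℝ → ℝ → PhaseL2) (z : ℝ) (k l : ℕ) (t : ℝ) : PhaseL2 :=
  iteratedDerivWithin l (fun t => q p k z t) (Ici 0) t

/-- The coefficients of the hierarchy, relative to `√T`. -/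
noncomputable def coupling (T : ℝ → ℝ) (z : ℝ) (k j : ℕ) : ℝ :=
  (k.choose j : ℝ) * sqrtDeriv T (k - j) z / √(T z)

/-- `√T v ∂ₓ ∂ₜ^l q⁽ᵏ⁾`, expressed through the equations. -/
noncomputable def transportTerm (T : ℝ → ℝ) (p : ℝ → ℝ → PhaseL2) (z : ℝ) (k l : ℕ) (t : ℝ) :
    PhaseL2 :=
  solveTri (coupling T z) (fun j => L1 (qDeriv p z j l t) - qDeriv p z j (l + 1) t) k

lemma transportTerm_equation (T : ℝ → ℝ) (p : ℝ → ℝ → PhaseL2) (z : ℝ) (k l : ℕ) (t : ℝ) :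
    qDeriv p z k (l + 1) t + transportTerm T p z k l t +
      ∑ j ∈ Finset.range k, coupling T z k j • transportTerm T p z j l t =
      L1 (qDeriv p z k l t) := by
  rw [add_assoc]
  simp only [transportTerm]
  rw [solveTri_add_sum]
  abel

lemma IsSolution.hasDerivWithinAt_qDeriv (hp : IsSolution n Z T p) {z : ℝ} (hz : z ∈ Z) {k l : ℕ}
    (hkl : k + l ≤ n) {t : ℝ} (ht : 0 ≤ t) :
    HasDerivWithinAt (qDeriv p z k l) (qDeriv p z k (l + 1) t) (Ici 0) t := by
  have h := (hp.contDiffOn_t z hz k (by omega)).differentiableOn_iteratedDerivWithin (m := l)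
    (by exact_mod_cast (by omega : l < n + 1 - k)) (uniqueDiffOn_Ici 0)
  have h1 := (h t ht).hasDerivWithinAt
  rwa [← iteratedDerivWithin_succ] at h1

/-- The witnesses `w` in `eqn` carry no regularity in time; the explicit formula inherits it from
the `qDeriv`, as `L1` is bounded and linear. -/
lemma IsSolution.hasDerivWithinAt_transportTerm (hp : IsSolution n Z T p) {z : ℝ} (hz : z ∈ Z)
    {k l : ℕ} (hkl : k + l + 1 ≤ n) {t : ℝ} (ht : 0 ≤ t) :
    HasDerivWithinAt (transportTerm T p z k l) (transportTerm T p z k (l + 1) t) (Ici 0) t :=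
  hasDerivWithinAt_solveTri k fun j hj =>
    (collisionCLM.hasFDerivAt.comp_hasDerivWithinAt t
      (hp.hasDerivWithinAt_qDeriv hz (by omega) ht)).sub
        (hp.hasDerivWithinAt_qDeriv hz (by omega) ht)

lemma IsSolution.isTransport_transportTerm_zero (hp : IsSolution n Z T p) {z : ℝ} (hz : z ∈ Z)
    (hT : 0 < T z) {t : ℝ} (ht : 0 ≤ t) (k : ℕ) (hk : k ≤ n) :
    IsTransport (√(T z) • qDeriv p z k 0 t) (transportTerm T p z k 0 t) := by
  induction k using Nat.strong_induction_on with
  | _ k ih =>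
  obtain ⟨w, hw, heq⟩ := hp.eqn z hz t ht k hk
  have hc : √(T z) ≠ 0 := (Real.sqrt_pos.2 hT).ne'
  have hq0 : ∀ j, qDeriv p z j 0 t = q p j z t := fun j => by simp [qDeriv]
  have hq1 : qDeriv p z k 1 t = derivWithin (fun s => q p k z s) (Ici 0) t := by
    simp [qDeriv, iteratedDerivWithin_one]
  -- By uniqueness of `v ∂ₓ`, the lower witnesses agree with the terms already identified; the
  -- equation then determines the top one.
  have hlower : ∀ j ∈ Finset.range k, ((k.choose j : ℝ) * sqrtDeriv T (k - j) z) • w j =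
      coupling T z k j • transportTerm T p z j 0 t := by
    intro j hj
    have hj' := Finset.mem_range.1 hj
    have h1 := ih j hj' (by omega)
    rw [hq0] at h1
    rw [h1.unique ((hw j hj'.le).smul _), smul_smul, coupling, div_mul_cancel₀ _ hc]
  have htop : √(T z) • w k = transportTerm T p z k 0 t := by
    have h1 := transportTerm_equation T p z k 0 t
    rw [Finset.sum_range_succ, Finset.sum_congr rfl hlower, ← hq0 k, ← h1, zero_add, hq1] at heq
    have h2 : sqrtDeriv T (k - k) z = √(T z) := by simp [sqrtDeriv]
    rw [h2, Nat.choose_self, Nat.cast_one, one_mul] at heq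
    rw [add_assoc, add_right_inj, add_comm, add_left_inj] at heq
    exact heq
  rw [← htop, hq0]
  exact (hw k le_rfl).smul _

/-- The transport relation is linear and closed, so it may be differentiated in time, from `l` to `l
+ 1`. -/
lemma IsSolution.isTransport_transportTerm (hp : IsSolution n Z T p) {z : ℝ} (hz : z ∈ Z)
    (hT : 0 < T z) (l : ℕ) : ∀ k, k + l ≤ n → ∀ t, 0 ≤ t →
    IsTransport (√(T z) • qDeriv p z k l t) (transportTerm T p z k l t) := by
  induction l with
  | zero => exact fun k hk t ht => hp.isTransport_transportTerm_zero hz hT ht k hk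
  | succ l ih =>
    intro k hk t ht
    exact isTransport_of_hasDerivWithinAt (uniqueDiffOn_Ici 0 t ht) ht
      (fun r hr => ih k (by omega) r hr)
      ((hp.hasDerivWithinAt_qDeriv hz (by omega) ht).const_smul (√(T z)))
      (hp.hasDerivWithinAt_transportTerm hz (by omega) ht)

lemma abs_coupling_le {N : ℕ} {B z : ℝ} (hT : 0 < T z)
    (hB : ∀ m : ℕ, 1 ≤ m → m ≤ N → |sqrtDeriv T m z| ≤ B * √(T z)) {k j : ℕ} (hk : k ≤ N)
    (hj : j < k) : |coupling T z k j| ≤ 2 ^ N * |B| := by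
  have hc : 0 < √(T z) := Real.sqrt_pos.2 hT
  rw [coupling, abs_div, abs_mul, abs_of_pos hc, div_le_iff₀ hc, mul_assoc, Nat.abs_cast]
  have h1 : (k.choose j : ℝ) ≤ 2 ^ N := by
    exact_mod_cast (Nat.choose_le_two_pow k j).trans (Nat.pow_le_pow_right (by norm_num) hk)
  have h2 : |sqrtDeriv T (k - j) z| ≤ |B| * √(T z) :=
    (hB (k - j) (by omega) (by omega)).trans (mul_le_mul_of_nonneg_right (le_abs_self B) hc.le)
  gcongr

lemma dataNorm_nonneg (p : ℝ → ℝ → PhaseL2) (N : ℕ) (z : ℝ) : 0 ≤ dataNorm p N z :=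
  Finset.sum_nonneg fun _ _ => Finset.sum_nonneg fun _ _ => norm_nonneg _

/-- Only the summands with the zeroth power of `L1` are needed. -/
lemma norm_qDeriv_zero_le_dataNorm (p : ℝ → ℝ → PhaseL2) {N l : ℕ} (z : ℝ) (hl : l ≤ N) :
    ‖qDeriv p z 0 l 0‖ ≤ dataNorm p N z := by
  rw [dataNorm, Finset.sum_range_succ']
  refine le_trans ?_ (le_add_of_nonneg_left (Finset.sum_nonneg fun _ _ =>
    Finset.sum_nonneg fun _ _ => norm_nonneg _))
  simp only [Function.iterate_zero, id]
  exact Finset.single_le_sum (f := fun l => ‖qDeriv p z 0 l 0‖) (fun _ _ => norm_nonneg _)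
    (Finset.mem_range.2 (Nat.lt_succ_of_le hl))

end Solution

end LinBGK

theorem theorem4p2 (N : ℕ) (B : ℝ) :
    ∃ K : ℝ, 0 ≤ K ∧
      ∀ (n : ℕ), N ≤ n →
      ∀ (Z : Set ℝ) (T : ℝ → ℝ) (p : ℝ → ℝ → LinBGK.PhaseL2),
        IsOpen Z → (∀ z ∈ Z, 0 < T z) → ContDiffOn ℝ n T Z →
        LinBGK.IsSolution n Z T p →
        ∀ z ∈ Z,
          (∀ m : ℕ, 1 ≤ m → m ≤ N → |LinBGK.sqrtDeriv T m z| ≤ B * √(T z)) →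
          ∀ C : ℝ, K * LinBGK.dataNorm p N z < C →
            ∀ᶠ t in atTop, ‖LinBGK.q p N z t‖ ≤ C * t ^ N := by
  -- The hierarchy constant at level `N` with `b = 2^N |B|`, where `2^N` bounds the binomial
  -- coefficients.
  refine ⟨2 * (1 + 3 * (2 ^ N * |B|)) ^ N, by positivity, ?_⟩
  intro n hn Z T p _ hT _ hp z hz hB C hC
  have hc : √(T z) ≠ 0 := (Real.sqrt_pos.2 (hT z hz)).ne'
  have h := (LinBGK.growsLike_of_hierarchy (L := LinBGK.L1) LinBGK.norm_L1_le
    LinBGK.inner_L1_self_nonpos (b := 2 ^ N * |B|) (by positivity)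
    (β := LinBGK.coupling T z) (fun k hk j hj => LinBGK.abs_coupling_le (hT z hz) hB hk hj)
    (Q := LinBGK.qDeriv p z) (W := LinBGK.transportTerm T p z)
    (fun k l hkl t ht => hp.hasDerivWithinAt_qDeriv hz (hkl.trans hn) ht)
    (fun k l _ t _ => LinBGK.transportTerm_equation T p z k l t)
    -- Skewness applies to the pair `√T • Q`, `W`; the nonzero factor `√T` is then cancelled.
    (fun k l hkl t ht => by
      have h := (hp.isTransport_transportTerm hz (hT z hz) l k (hkl.trans hn) t ht).inner_eq_zero
      rw [real_inner_smul_left] at h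
      exact (mul_eq_zero.1 h).resolve_left hc)
    (LinBGK.dataNorm_nonneg p N z)
    (fun l hl => LinBGK.norm_qDeriv_zero_le_dataNorm p z hl) N).1 0 le_rfl C hC
  simpa [LinBGK.qDeriv] using h
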